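/- Consider the asymmetric simple exclusion process on $\{0,1,2,\dots\}$ with an open boundary at $0$: each particle jumps one step to the right at rate $p$ and, unless it is at $0$, one step to the left at rate $q=1-p$, jumps to occupied sites being suppressed; a particle is injected at site $0$ at rate $\alpha$ whenever site $0$ is empty; and no particle is ever ejected ($\beta=0$). That is, the process is the continuous-time Markov chain with these transition rates on the finite subsets (sets of occupied sites) of $\{0,1,2,\dots\}$. Assume $0<p\le 1$, $q=1-p$ and $\alpha>0$, and suppose that at time $0$ there is exactly one particle, at a site $y\ge 0$. Then with probability one a second particle is eventually injected. If moreover $q>0$, then the expected value of the time at which the second particle is injected is $$\frac1\alpha+\frac{\xi_+(\alpha)^{-y}}{q\,(\xi_+(\alpha)-1)-\alpha},\qquad \xi_+(\alpha)=\frac{\alpha+1+\sqrt{(\alpha+1)^2-4pq}}{2q}.$$ -/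

import Mathlib

open MeasureTheory
open scoped NNReal ENNReal

noncomputable section

/-- Total rate at which a chain with off-diagonal transition rates `Q` leaves the state `z`. -/
def totalRate {S : Type*} (Q : S → S → ℝ) (z : S) : ℝ := ∑' w, Q z w

open Classical in
/-- Transition probabilities of the embedded jump chain (an absorbing state is never left). -/
def jumpProb {S : Type*} (Q : S → S → ℝ) (z w : S) : ℝ :=
  if totalRate Q z = 0 then (if w = z then 1 else 0) else Q z w / totalRate Q z

open Classical in
/-- `X` is a continuous-time Markov chain with (off-diagonal) transition rates `Q`, started at
`x₀`, in the sense of the jump-chain / holding-time description: `Z` is the sequence of visited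
states, which is a discrete Markov chain with transition matrix `jumpProb Q` started at `x₀`; given
`Z`, the holding times `H 0, H 1, …` are independent, `H i` being exponential of rate
`totalRate Q (Z i)` (identically infinite when that rate is zero); and `X` sits in the
state `Z n` from time `H 0 + ⋯ + H (n - 1)` until just before time `H 0 + ⋯ + H n`. -/
def IsMarkovJumpProcess {S Ω : Type*} [MeasurableSpace Ω] (Q : S → S → ℝ) (x₀ : S)
    (P : Measure Ω) (X : ℝ≥0 → Ω → S) : Prop :=
  ∃ (Z : ℕ → Ω → S) (H : ℕ → Ω → ℝ≥0∞),
    (∀ n z, MeasurableSet {ω | Z n ω = z}) ∧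
    (∀ n, Measurable (H n)) ∧
    (∀ (n : ℕ) (z : ℕ → S) (t : ℕ → ℝ≥0),
      P {ω | ∀ i ≤ n, Z i ω = z i ∧ (t i : ℝ≥0∞) < H i ω} =
        ENNReal.ofReal ((if z 0 = x₀ then 1 else 0) *
          (∏ i ∈ Finset.range n, jumpProb Q (z i) (z (i + 1))) *
          ∏ i ∈ Finset.range (n + 1), Real.exp (-(totalRate Q (z i) * (t i : ℝ))))) ∧
    (∀ᵐ ω ∂P, ∀ (n : ℕ) (t : ℝ≥0),
      ∑ i ∈ Finset.range n, H i ω ≤ (t : ℝ≥0∞) →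
      (t : ℝ≥0∞) < ∑ i ∈ Finset.range (n + 1), H i ω →
      X t ω = Z n ω)

/-- Transition rates of the asymmetric simple exclusion process on `{0, 1, 2, …}` with an open
boundary at `0`. A configuration is the finite set of occupied sites. A particle jumps right at
rate `p` and (unless at `0`) left at rate `q`, provided that the target site is empty; a particle
is injected at site `0` at rate `α` if it is empty, and a particle at `0` is ejected at
rate `β`. -/
def openASEPRate (p q α β : ℝ) (η ζ : Finset ℕ) : ℝ :=
  (∑ x ∈ η, if x + 1 ∉ η ∧ ζ = insert (x + 1) (η.erase x) then p else 0) +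
  (∑ x ∈ η, if 0 < x ∧ x - 1 ∉ η ∧ ζ = insert (x - 1) (η.erase x) then q else 0) +
  (if 0 ∉ η ∧ ζ = insert 0 η then α else 0) +
  (if 0 ∈ η ∧ ζ = η.erase 0 then β else 0)

/-- First time at which the system holds two particles (`∞` if this never happens). -/
def secondParticleTime {Ω : Type*} (X : ℝ≥0 → Ω → Finset ℕ) (ω : Ω) : ℝ≥0∞ :=
  ⨅ (t : ℝ≥0) (_ : (X t ω).card = 2), (t : ℝ≥0∞)

/-- The larger root `ξ` of `p / ξ + q * ξ - 1 = s`. -/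
def xiPlus (p q s : ℝ) : ℝ :=
  (s + 1 + Real.sqrt ((s + 1) ^ 2 - 4 * p * q)) / (2 * q)

end

/-!
Until the second injection the system is a single particle performing a random walk on
`{0, 1, 2, …}` that is killed at rate `α` whenever it is away from `0`. Its mean killing time
`f x` from the site `x` solves the Poisson equation

  `p f(0) = 1 + p f(1)`,  `(1 + α) f(x) = 1 + p f(x + 1) + q f(x - 1)` for `x ≥ 1`.

For `q > 0` a bounded nonnegative solution is `1 / α + c ξ ^ (-x)`, where `ξ = xiPlus p q α > 1` is
a root of `p / ξ + q ξ = 1 + α` and the equation at `0` gives `c = 1 / (q (ξ - 1) - α)`; for `q = 0`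
one may take `f 0 = 1 / α + 1 / p` and `f x = 1 / α` for `x ≥ 1`.

The mean killing time is identified with `f` through the jump chain `Z n` and the holding times
`H n`. The finite-dimensional law yields the Markov property of `Z`
(`IsJumpChain.measure_transition`) and the mean holding times `E[H n; Z n = x] = P(Z n = x) / r x`
with `r x` the total rate (`IsJumpChain.setLIntegral_holding`); by Dynkin's formula the sum over `n`
of `E[1 / r (Z n)]`, restricted to one-particle configurations, equals `f y` up to a remainder
`E[f (Z n)]`, which vanishes in the limit because `f` is bounded, `r ≤ 1 + α` and the sum is finite
(`IsJumpChain.tsum_lintegral_state`). Finiteness of this sum also shows that the chain almost surely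
leaves the one-particle configurations, in finite time. As the particle number grows by at most
one per jump and holding times are positive, the arrival time of the second particle is the total
time spent in one-particle configurations (`secondParticleTime_eq_tsum`).
-/

/-! ### Jump chains -/

open Classical in
/-- The jump chain `Z` and the holding times `H` of a continuous-time Markov chain with rates `Q`
started at `x₀`: the part of `IsMarkovJumpProcess` that does not mention the process itself. -/
structure IsJumpChain {S Ω : Type*} [MeasurableSpace Ω] (Q : S → S → ℝ) (x₀ : S)
    (P : Measure Ω) (Z : ℕ → Ω → S) (H : ℕ → Ω → ℝ≥0∞) : Prop where
  measurableSet_state : ∀ n z, MeasurableSet {ω | Z n ω = z}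
  measurable_holding : ∀ n, Measurable (H n)
  law : ∀ (n : ℕ) (z : ℕ → S) (t : ℕ → ℝ≥0),
      P {ω | ∀ i ≤ n, Z i ω = z i ∧ (t i : ℝ≥0∞) < H i ω} =
        ENNReal.ofReal ((if z 0 = x₀ then 1 else 0) *
          (∏ i ∈ Finset.range n, jumpProb Q (z i) (z (i + 1))) *
          ∏ i ∈ Finset.range (n + 1), Real.exp (-(totalRate Q (z i) * (t i : ℝ))))

section JumpProb

variable {S : Type*} {Q : S → S → ℝ}

lemma totalRate_nonneg (hQ : ∀ z w, 0 ≤ Q z w) (z : S) : 0 ≤ totalRate Q z :=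
  tsum_nonneg (hQ z)

lemma jumpProb_nonneg (hQ : ∀ z w, 0 ≤ Q z w) (z w : S) : 0 ≤ jumpProb Q z w := by
  unfold jumpProb
  split_ifs
  · exact zero_le_one
  · exact le_rfl
  · exact div_nonneg (hQ z w) (totalRate_nonneg hQ z)

/-- The rows of the embedded chain sum to one. No summability is assumed: when the rates out of
`z` are not summable, `totalRate Q z` is `0` and the row is that of an absorbing state. -/
lemma tsum_ofReal_jumpProb (hQ : ∀ z w, 0 ≤ Q z w) (z : S) :
    ∑' w, ENNReal.ofReal (jumpProb Q z w) = 1 := by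
  classical
  unfold jumpProb
  split_ifs with h
  · rw [tsum_eq_single z]
    · simp
    · intro w hw
      simp [hw]
  · have hs : Summable (Q z) := by
      by_contra hs
      exact h (tsum_eq_zero_of_not_summable hs)
    rw [← ENNReal.ofReal_tsum_of_nonneg
      (fun w => div_nonneg (hQ z w) (totalRate_nonneg hQ z)) (hs.div_const _), tsum_div_const]
    change ENNReal.ofReal (totalRate Q z / totalRate Q z) = 1
    rw [div_self h, ENNReal.ofReal_one]

end JumpProb

/-! ### Auxiliary integrals and decompositions -/

/-- Layer-cake formula for functions with values in `[0, ∞]`. -/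
lemma lintegral_eq_lintegral_ofReal_lt {Ω : Type*} [MeasurableSpace Ω] (μ : Measure Ω) [SFinite μ]
    {f : Ω → ℝ≥0∞} (hf : Measurable f) :
    ∫⁻ ω, f ω ∂μ = ∫⁻ t in Set.Ioi (0 : ℝ), μ {ω | ENNReal.ofReal t < f ω} := by
  have key : ∀ a : ℝ≥0∞,
      a = ∫⁻ t in Set.Ioi (0 : ℝ), Set.indicator {t : ℝ | ENNReal.ofReal t < a} 1 t := by
    intro a
    rw [lintegral_indicator_one (measurableSet_lt ENNReal.measurable_ofReal measurable_const),
      Measure.restrict_apply (measurableSet_lt ENNReal.measurable_ofReal measurable_const)]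
    induction a with
    | top => simp
    | coe a =>
      have : {t : ℝ | ENNReal.ofReal t < a} ∩ Set.Ioi 0 = Set.Ioo 0 (a : ℝ) := by
        ext t
        simp only [Set.mem_inter_iff, Set.mem_ofPred_eq, Set.mem_Ioi, Set.mem_Ioo]
        constructor
        · rintro ⟨h1, h2⟩
          refine ⟨h2, ?_⟩
          rwa [← ENNReal.ofReal_coe_nnreal, ENNReal.ofReal_lt_ofReal_iff_of_nonneg h2.le] at h1
        · rintro ⟨h1, h2⟩
          refine ⟨?_, h1⟩
          rwa [← ENNReal.ofReal_coe_nnreal, ENNReal.ofReal_lt_ofReal_iff_of_nonneg h1.le]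
      rw [this, Real.volume_Ioo, sub_zero, ENNReal.ofReal_coe_nnreal]
  have hm : MeasurableSet {x : Ω × ℝ | ENNReal.ofReal x.2 < f x.1} :=
    measurableSet_lt (ENNReal.measurable_ofReal.comp measurable_snd) (hf.comp measurable_fst)
  calc ∫⁻ ω, f ω ∂μ
      = ∫⁻ ω, (∫⁻ t in Set.Ioi (0 : ℝ),
          Set.indicator {x : Ω × ℝ | ENNReal.ofReal x.2 < f x.1} 1 (ω, t)) ∂μ :=
        lintegral_congr fun ω => key (f ω)
    _ = ∫⁻ t in Set.Ioi (0 : ℝ), (∫⁻ ω,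
          Set.indicator {x : Ω × ℝ | ENNReal.ofReal x.2 < f x.1} 1 (ω, t) ∂μ) :=
        lintegral_lintegral_swap (measurable_one.indicator hm).aemeasurable
    _ = _ := by
        refine lintegral_congr fun t => ?_
        exact lintegral_indicator_one (s := {ω | ENNReal.ofReal t < f ω})
          (measurableSet_lt measurable_const hf)

lemma lintegral_exp_neg_mul_Ioi {r : ℝ} (hr : 0 < r) :
    ∫⁻ t in Set.Ioi (0 : ℝ), ENNReal.ofReal (Real.exp (-(r * t))) = (ENNReal.ofReal r)⁻¹ := by
  have hi := integrableOn_exp_mul_Ioi (neg_lt_zero.2 hr) 0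
  have he := integral_exp_mul_Ioi (neg_lt_zero.2 hr) 0
  simp only [neg_mul] at hi he
  rw [← ofReal_integral_eq_lintegral_ofReal hi (ae_of_all _ fun t => (Real.exp_pos _).le), he,
    ← ENNReal.ofReal_inv_of_pos hr]
  simp

/-- Decomposition of an event according to the value of a map into a countable type. -/
lemma measure_eq_tsum_inter_fiber {S Ω : Type*} [MeasurableSpace Ω] [Countable S] (μ : Measure Ω)
    {Y : Ω → S} (hY : ∀ z, MeasurableSet {ω | Y ω = z}) (A : Set Ω) :
    μ A = ∑' z, μ (A ∩ {ω | Y ω = z}) := by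
  have hd : Pairwise (Function.onFun Disjoint fun z => {ω | Y ω = z}) := by
    intro z w hzw
    rw [Function.onFun, Set.disjoint_left]
    intro ω h1 h2
    exact hzw (h1.symm.trans h2)
  have hu : ⋃ z, {ω | Y ω = z} = Set.univ := by
    ext ω
    simp
  rw [← Measure.restrict_apply_univ, ← hu, measure_iUnion hd hY]
  exact tsum_congr fun z => by rw [Measure.restrict_apply (hY z), Set.inter_comm]

/-- Decomposition of an integral according to the value of a map into a countable type. -/
lemma lintegral_eq_tsum_setLIntegral_fiber {S Ω : Type*} [MeasurableSpace Ω] [Countable S]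
    (μ : Measure Ω) {Y : Ω → S} (hY : ∀ z, MeasurableSet {ω | Y ω = z}) (f : Ω → ℝ≥0∞) :
    ∫⁻ ω, f ω ∂μ = ∑' z, ∫⁻ ω in {ω | Y ω = z}, f ω ∂μ := by
  rw [← lintegral_iUnion hY, ← setLIntegral_univ]
  · congr 2
    ext ω
    simp
  · intro z w hzw
    rw [Function.onFun, Set.disjoint_left]
    intro ω h1 h2
    exact hzw (h1.symm.trans h2)

/-! ### The Markov property and Dynkin's formula -/

namespace IsJumpChain

variable {S Ω : Type*} [MeasurableSpace Ω] {Q : S → S → ℝ} {x₀ : S}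
  {P : Measure Ω} {Z : ℕ → Ω → S} {H : ℕ → Ω → ℝ≥0∞}

lemma measurableSet_state_mem [Countable S] (h : IsJumpChain Q x₀ P Z H) (n : ℕ) (A : Set S) :
    MeasurableSet {ω | Z n ω ∈ A} := by
  have : {ω | Z n ω ∈ A} = ⋃ z ∈ A, {ω | Z n ω = z} := by
    ext ω
    simp
  rw [this]
  exact MeasurableSet.biUnion A.to_countable fun z _ => h.measurableSet_state n z

lemma measure_path_holding (h : IsJumpChain Q x₀ P Z H) (n : ℕ) (z : ℕ → S)
    (t : ℝ≥0) :
    P ({ω | ∀ i ≤ n, Z i ω = z i ∧ 0 < H i ω} ∩ {ω | (t : ℝ≥0∞) < H n ω}) =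
      P {ω | ∀ i ≤ n, Z i ω = z i ∧ 0 < H i ω} *
        ENNReal.ofReal (Real.exp (-(totalRate Q (z n) * t))) := by
  have h1 := h.law n z (fun i => if i = n then t else 0)
  have h0 := h.law n z 0
  have e1 : {ω | ∀ i ≤ n, Z i ω = z i ∧ (((fun i => if i = n then t else 0 : ℕ → ℝ≥0) i : ℝ≥0)
      : ℝ≥0∞) < H i ω} =
      {ω | ∀ i ≤ n, Z i ω = z i ∧ 0 < H i ω} ∩ {ω | (t : ℝ≥0∞) < H n ω} := by
    ext ω
    simp only [Set.mem_ofPred_eq, Set.mem_inter_iff]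
    constructor
    · intro hω
      refine ⟨fun i hi => ⟨(hω i hi).1, lt_of_le_of_lt zero_le (hω i hi).2⟩, ?_⟩
      simpa using (hω n le_rfl).2
    · rintro ⟨h1, h2⟩ i hi
      refine ⟨(h1 i hi).1, ?_⟩
      split_ifs with hin
      · exact hin ▸ h2
      · exact (h1 i hi).2
  rw [e1] at h1
  simp only [Pi.zero_apply, ENNReal.coe_zero, NNReal.coe_zero, mul_zero, neg_zero, Real.exp_zero,
    Finset.prod_const_one, mul_one] at h0
  rw [h1, h0, ← ENNReal.ofReal_mul']
  · congr 2
    rw [Finset.prod_range_succ, Finset.prod_eq_one]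
    · simp
    · intro i hi
      simp [(Finset.mem_range.1 hi).ne]
  · exact (Real.exp_pos _).le

lemma measure_path_succ (h : IsJumpChain Q x₀ P Z H) (hQ : ∀ z w, 0 ≤ Q z w) (n : ℕ) (z : ℕ → S) :
    P {ω | ∀ i ≤ n + 1, Z i ω = z i ∧ 0 < H i ω} =
      P {ω | ∀ i ≤ n, Z i ω = z i ∧ 0 < H i ω} *
        ENNReal.ofReal (jumpProb Q (z n) (z (n + 1))) := by
  have h1 := h.law (n + 1) z 0
  have h0 := h.law n z 0
  simp only [Pi.zero_apply, ENNReal.coe_zero, NNReal.coe_zero, mul_zero, neg_zero, Real.exp_zero,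
    Finset.prod_const_one, mul_one] at h0 h1
  rw [h1, h0, ← ENNReal.ofReal_mul' (jumpProb_nonneg hQ _ _), Finset.prod_range_succ, mul_assoc]

/-- Summation over all histories `Z 0, …, Z n`. The path `s` is extended to all of `ℕ` in order to
match the form of `IsJumpChain.law`; only its values at `i ≤ n` matter. -/
lemma measure_eq_tsum_history [Countable S] (h : IsJumpChain Q x₀ P Z H) (n : ℕ) (A : Set Ω)
    (hA : A ⊆ {ω | ∀ i ≤ n, 0 < H i ω}) :
    P A = ∑' s : Fin (n + 1) → S, P ({ω | ∀ i ≤ n, Z i ω = s (Fin.ofNat (n + 1) i) ∧ 0 < H i ω} ∩ A)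
    := by
  rw [measure_eq_tsum_inter_fiber P (Y := fun ω (i : Fin (n + 1)) => Z i ω) _ A]
  · refine tsum_congr fun s => congrArg P ?_
    ext ω
    simp only [Set.mem_inter_iff, Set.mem_ofPred_eq, funext_iff]
    constructor
    · rintro ⟨h1, h2⟩
      refine ⟨fun i hi => ⟨?_, hA h1 i hi⟩, h1⟩
      rw [← h2, Fin.val_ofNat, Nat.mod_eq_of_lt (Nat.lt_succ_of_le hi)]
    · rintro ⟨h1, h2⟩
      refine ⟨h2, fun i => ?_⟩
      rw [(h1 i (Nat.le_of_lt_succ i.2)).1]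
      simp
  · intro s
    simp only [funext_iff, Set.ofPred_forall]
    exact MeasurableSet.iInter fun i => h.measurableSet_state i _

/-- If an event contained in `{Z n = x}` has the same conditional probability `c` given each history
ending in `x`, then `c` is its conditional probability given `Z n = x`. -/
lemma measure_eq_mul_of_path [Countable S] (h : IsJumpChain Q x₀ P Z H) (n : ℕ) (x : S) (A : Set Ω)
    (hA : A ⊆ {ω | (∀ i ≤ n, 0 < H i ω) ∧ Z n ω = x}) (c : ℝ≥0∞)
    (hc : ∀ z : ℕ → S, z n = x → P ({ω | ∀ i ≤ n, Z i ω = z i ∧ 0 < H i ω} ∩ A) =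
      P {ω | ∀ i ≤ n, Z i ω = z i ∧ 0 < H i ω} * c) :
    P A = P {ω | (∀ i ≤ n, 0 < H i ω) ∧ Z n ω = x} * c := by
  rw [h.measure_eq_tsum_history n A fun ω hω => (hA hω).1,
    h.measure_eq_tsum_history n {ω | (∀ i ≤ n, 0 < H i ω) ∧ Z n ω = x} fun ω hω => hω.1,
    ← ENNReal.tsum_mul_right]
  refine tsum_congr fun s => ?_
  by_cases hs : s (Fin.ofNat (n + 1) n) = x
  · rw [hc (fun i => s (Fin.ofNat (n + 1) i)) hs, Set.inter_eq_left.2]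
    intro ω hω
    exact ⟨fun i hi => (hω i hi).2, (hω n le_rfl).1.trans hs⟩
  · have he : ∀ B ⊆ {ω | (∀ i ≤ n, 0 < H i ω) ∧ Z n ω = x},
        {ω | ∀ i ≤ n, Z i ω = s (Fin.ofNat (n + 1) i) ∧ 0 < H i ω} ∩ B = ∅ := by
      intro B hB
      refine Set.eq_empty_of_forall_notMem fun ω hω => hs ?_
      exact (hω.1 n le_rfl).1.symm.trans (hB hω.2).2
    rw [he A hA, he _ subset_rfl]
    simp

/-- The Markov property, stated together with positivity of the holding times: `IsJumpChain.law`
only speaks of events on which the holding times are positive, and that these have full measure is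
a consequence (`ae_holding_pos`). -/
lemma measure_pos_transition [Countable S] (h : IsJumpChain Q x₀ P Z H) (hQ : ∀ z w, 0 ≤ Q z w)
    (n : ℕ) (x w : S) :
    P {ω | (∀ i ≤ n + 1, 0 < H i ω) ∧ Z n ω = x ∧ Z (n + 1) ω = w} =
      P {ω | (∀ i ≤ n, 0 < H i ω) ∧ Z n ω = x} * ENNReal.ofReal (jumpProb Q x w) := by
  refine h.measure_eq_mul_of_path n x _ ?_ _ ?_
  · rintro ω ⟨h1, h2, -⟩
    exact ⟨fun i hi => h1 i (hi.trans n.le_succ), h2⟩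
  · intro z hz
    have := h.measure_path_succ hQ n (fun i => if i = n + 1 then w else z i)
    simp only [if_neg n.succ_ne_self.symm, if_true, hz] at this
    convert! this using 2
    · ext ω
      simp only [Set.mem_inter_iff, Set.mem_ofPred_eq]
      constructor
      · rintro ⟨h1, h2, -, h4⟩ i hi
        refine ⟨?_, h2 i hi⟩
        split_ifs with hin
        · exact hin ▸ h4
        · exact (h1 i (by omega)).1
      · intro h1
        refine ⟨fun i hi => ?_, fun i hi => (h1 i hi).2, ?_, ?_⟩
        · have := h1 i (by omega)
          rwa [if_neg (by omega)] at this
        · have := (h1 n (by omega)).1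
          rwa [if_neg (by omega), hz] at this
        · have := (h1 (n + 1) le_rfl).1
          rwa [if_pos rfl] at this
    · congr 1
      ext ω
      simp only [Set.mem_ofPred_eq]
      refine forall₂_congr fun i hi => ?_
      rw [if_neg (by omega)]

open Classical in
lemma measure_init (h : IsJumpChain Q x₀ P Z H) (x : S) :
    P {ω | Z 0 ω = x ∧ 0 < H 0 ω} = if x = x₀ then 1 else 0 := by
  have := h.law 0 (fun _ => x) 0
  simp only [Nat.le_zero, forall_eq, Pi.zero_apply, ENNReal.coe_zero, NNReal.coe_zero, mul_zero,
    neg_zero, Real.exp_zero, Finset.prod_const_one, mul_one, Finset.range_zero,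
    Finset.prod_empty] at this
  rw [this]
  split_ifs <;> simp

/-- The holding times are almost surely positive: the rows of the embedded chain sum to one, so
that the law with all `t i = 0` already has total mass one. -/
lemma ae_holding_pos [Countable S] [IsProbabilityMeasure P] (h : IsJumpChain Q x₀ P Z H)
    (hQ : ∀ z w, 0 ≤ Q z w) : ∀ᵐ ω ∂P, ∀ n, 0 < H n ω := by
  classical
  have hB : ∀ n, MeasurableSet {ω | ∀ i ≤ n, 0 < H i ω} := by
    intro n
    simp only [Set.ofPred_forall]
    exact MeasurableSet.iInter fun i => MeasurableSet.iInter fun _ =>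
      measurableSet_lt measurable_const (h.measurable_holding i)
  have h1 : ∀ n, P {ω | ∀ i ≤ n, 0 < H i ω} = 1 := by
    intro n
    induction n with
    | zero =>
      simp only [Nat.le_zero, forall_eq]
      rw [measure_eq_tsum_inter_fiber P (h.measurableSet_state 0)]
      have he : ∀ x, P ({ω | 0 < H 0 ω} ∩ {ω | Z 0 ω = x}) = if x = x₀ then 1 else 0 := by
        intro x
        rw [← h.measure_init x]
        congr 1
        ext ω
        exact and_comm
      rw [tsum_congr he, tsum_ite_eq]
    | succ n ih =>
      rw [← ih, measure_eq_tsum_inter_fiber P (h.measurableSet_state n),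
        measure_eq_tsum_inter_fiber P (h.measurableSet_state n) {ω | ∀ i ≤ n, 0 < H i ω}]
      refine tsum_congr fun x => ?_
      have e1 : {ω | ∀ i ≤ n, 0 < H i ω} ∩ {ω | Z n ω = x} =
          {ω | (∀ i ≤ n, 0 < H i ω) ∧ Z n ω = x} := rfl
      rw [measure_eq_tsum_inter_fiber P (h.measurableSet_state (n + 1)), e1,
        ← mul_one (P {ω | _ ∧ _}), ← tsum_ofReal_jumpProb hQ x, ← ENNReal.tsum_mul_left]
      refine tsum_congr fun w => ?_
      rw [← h.measure_pos_transition hQ]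
      congr 1
      ext ω
      simp [and_assoc]
  rw [ae_all_iff]
  intro n
  have : ∀ᵐ ω ∂P, ω ∈ {ω | ∀ i ≤ n, 0 < H i ω} := (mem_ae_iff_prob_eq_one (hB n)).2 (h1 n)
  filter_upwards [this] with ω hω
  exact hω n le_rfl

lemma ae_init [Countable S] [IsProbabilityMeasure P] (h : IsJumpChain Q x₀ P Z H)
    (hQ : ∀ z w, 0 ≤ Q z w) : ∀ᵐ ω ∂P, Z 0 ω = x₀ := by
  have h1 : ∀ᵐ ω ∂P, ∀ x, x ≠ x₀ → ¬ (Z 0 ω = x ∧ 0 < H 0 ω) := by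
    rw [ae_all_iff]
    intro x
    by_cases hx : x = x₀
    · exact ae_of_all _ fun ω hne => absurd hx hne
    · have := h.measure_init x
      rw [if_neg hx] at this
      filter_upwards [measure_eq_zero_iff_ae_notMem.1 this] with ω hω _
      exact hω
  filter_upwards [h1, h.ae_holding_pos hQ] with ω h1 h2
  by_contra hne
  exact h1 _ hne ⟨rfl, h2 0⟩

lemma measure_pos_state [Countable S] [IsProbabilityMeasure P] (h : IsJumpChain Q x₀ P Z H)
    (hQ : ∀ z w, 0 ≤ Q z w) (n : ℕ) (x : S) :
    P {ω | (∀ i ≤ n, 0 < H i ω) ∧ Z n ω = x} = P {ω | Z n ω = x} := by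
  refine measure_congr ?_
  filter_upwards [h.ae_holding_pos hQ] with ω hω
  exact propext ⟨fun h => h.2, fun h => ⟨fun i _ => hω i, h⟩⟩

lemma measure_transition [Countable S] [IsProbabilityMeasure P] (h : IsJumpChain Q x₀ P Z H)
    (hQ : ∀ z w, 0 ≤ Q z w) (n : ℕ) (x w : S) :
    P {ω | Z n ω = x ∧ Z (n + 1) ω = w} =
      P {ω | Z n ω = x} * ENNReal.ofReal (jumpProb Q x w) := by
  rw [← h.measure_pos_state hQ, ← h.measure_pos_transition hQ]
  refine measure_congr ?_
  filter_upwards [h.ae_holding_pos hQ] with ω hω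
  exact propext ⟨fun h => ⟨fun i _ => hω i, h⟩, fun h => h.2⟩

lemma measure_state_holding [Countable S] [IsProbabilityMeasure P] (h : IsJumpChain Q x₀ P Z H)
    (hQ : ∀ z w, 0 ≤ Q z w) (n : ℕ) (x : S) (t : ℝ≥0) :
    P {ω | Z n ω = x ∧ (t : ℝ≥0∞) < H n ω} =
      P {ω | Z n ω = x} * ENNReal.ofReal (Real.exp (-(totalRate Q x * t))) := by
  rw [← h.measure_pos_state hQ, ← h.measure_eq_mul_of_path n x
    {ω | ((∀ i ≤ n, 0 < H i ω) ∧ Z n ω = x) ∧ (t : ℝ≥0∞) < H n ω} (fun ω hω => hω.1)]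
  · refine measure_congr ?_
    filter_upwards [h.ae_holding_pos hQ] with ω hω
    exact propext ⟨fun h => ⟨⟨fun i _ => hω i, h.1⟩, h.2⟩, fun h => ⟨h.1.2, h.2⟩⟩
  · intro z hz
    rw [← hz, ← h.measure_path_holding n z t]
    congr 1
    ext ω
    simp only [Set.mem_inter_iff, Set.mem_ofPred_eq]
    exact ⟨fun h => ⟨h.1, h.2.2⟩,
      fun h => ⟨h.1, ⟨fun i hi => (h.1 i hi).2, (h.1 n le_rfl).1⟩, h.2⟩⟩

/-- The mean holding time in `x` is the inverse of the total rate of `x`. -/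
lemma setLIntegral_holding [Countable S] [IsProbabilityMeasure P] (h : IsJumpChain Q x₀ P Z H)
    (hQ : ∀ z w, 0 ≤ Q z w) (n : ℕ) (x : S) (hx : 0 < totalRate Q x) :
    ∫⁻ ω in {ω | Z n ω = x}, H n ω ∂P =
      P {ω | Z n ω = x} * (ENNReal.ofReal (totalRate Q x))⁻¹ := by
  rw [lintegral_eq_lintegral_ofReal_lt _ (h.measurable_holding n), ← lintegral_exp_neg_mul_Ioi hx,
    ← lintegral_const_mul _ (by fun_prop)]
  refine setLIntegral_congr_fun measurableSet_Ioi fun t ht => ?_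
  have h1 := h.measure_state_holding hQ n x t.toNNReal
  rw [Real.coe_toNNReal t (Set.mem_Ioi.1 ht).le] at h1
  rw [Measure.restrict_apply (measurableSet_lt measurable_const (h.measurable_holding n))]
  refine Eq.trans (congrArg P ?_) h1
  ext ω
  exact and_comm

lemma ae_jumpProb_ne_zero [Countable S] [IsProbabilityMeasure P] (h : IsJumpChain Q x₀ P Z H)
    (hQ : ∀ z w, 0 ≤ Q z w) : ∀ᵐ ω ∂P, ∀ n, jumpProb Q (Z n ω) (Z (n + 1) ω) ≠ 0 := by
  have h1 : ∀ᵐ ω ∂P, ∀ n x w, jumpProb Q x w = 0 → ¬ (Z n ω = x ∧ Z (n + 1) ω = w) := by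
    simp only [ae_all_iff]
    intro n x w hxw
    refine (measure_eq_zero_iff_ae_notMem (s := {ω | Z n ω = x ∧ Z (n + 1) ω = w})).1 ?_
    rw [h.measure_transition hQ, hxw, ENNReal.ofReal_zero, mul_zero]
  filter_upwards [h1] with ω hω n h0
  exact hω n _ _ h0 ⟨rfl, rfl⟩

lemma lintegral_state [Countable S] (h : IsJumpChain Q x₀ P Z H) (n : ℕ) (F : S → ℝ≥0∞) :
    ∫⁻ ω, F (Z n ω) ∂P = ∑' x, P {ω | Z n ω = x} * F x := by
  rw [lintegral_eq_tsum_setLIntegral_fiber P (h.measurableSet_state n)]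
  refine tsum_congr fun x => ?_
  rw [setLIntegral_congr_fun (g := fun _ => F x) (h.measurableSet_state n x)
    fun ω (hω : Z n ω = x) => congrArg F hω, setLIntegral_const, mul_comm]

/-- One step of Dynkin's formula for the embedded chain. The equation is only needed on a set `R`
that the chain does not leave. -/
lemma lintegral_state_eq_add [Countable S] [IsProbabilityMeasure P] (h : IsJumpChain Q x₀ P Z H)
    (hQ : ∀ z w, 0 ≤ Q z w) {R : Set S} (hR : ∀ n, ∀ᵐ ω ∂P, Z n ω ∈ R) {F g : S → ℝ≥0∞}
    (hF : ∀ z ∈ R, F z = g z + ∑' w, ENNReal.ofReal (jumpProb Q z w) * F w) (n : ℕ) :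
    ∫⁻ ω, F (Z n ω) ∂P = ∫⁻ ω, g (Z n ω) ∂P + ∫⁻ ω, F (Z (n + 1) ω) ∂P := by
  have h1 : ∀ w, P {ω | Z (n + 1) ω = w} =
      ∑' x, P {ω | Z n ω = x} * ENNReal.ofReal (jumpProb Q x w) := by
    intro w
    rw [measure_eq_tsum_inter_fiber P (h.measurableSet_state n)]
    refine tsum_congr fun x => ?_
    rw [← h.measure_transition hQ]
    congr 1
    ext ω
    exact and_comm
  simp only [h.lintegral_state, h1, ← ENNReal.tsum_mul_right]
  rw [ENNReal.tsum_comm, ← ENNReal.tsum_add]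
  refine tsum_congr fun x => ?_
  simp only [mul_assoc, ENNReal.tsum_mul_left]
  rw [← mul_add]
  by_cases hx : x ∈ R
  · rw [hF x hx]
  · have : P {ω | Z n ω = x} = 0 := by
      rw [measure_eq_zero_iff_ae_notMem]
      filter_upwards [hR n] with ω hω hωx
      exact hx (hωx ▸ hω)
    simp [this]

/-- The expected total cost `g` along the chain is the solution `F` of the Poisson equation,
provided that `F` is bounded by a multiple of `g`: then finiteness of the total cost forces the
remainder `E F(Z n)` in Dynkin's formula to vanish in the limit. -/
lemma tsum_lintegral_state [Countable S] [IsProbabilityMeasure P] (h : IsJumpChain Q x₀ P Z H)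
    (hQ : ∀ z w, 0 ≤ Q z w) {R : Set S} (hR : ∀ n, ∀ᵐ ω ∂P, Z n ω ∈ R) {F g : S → ℝ≥0∞}
    (hF : ∀ z ∈ R, F z = g z + ∑' w, ENNReal.ofReal (jumpProb Q z w) * F w)
    {K : ℝ≥0∞} (hK : K ≠ ∞) (hFg : ∀ z, F z ≤ K * g z) (h0 : F x₀ ≠ ∞) :
    ∑' n, ∫⁻ ω, g (Z n ω) ∂P = F x₀ := by
  have hsum : ∀ n, F x₀ =
      ∑ k ∈ Finset.range n, ∫⁻ ω, g (Z k ω) ∂P + ∫⁻ ω, F (Z n ω) ∂P := by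
    intro n
    induction n with
    | zero =>
      rw [Finset.sum_range_zero, zero_add, lintegral_congr_ae (g := fun _ => F x₀)]
      · simp
      · filter_upwards [h.ae_init hQ] with ω hω
        rw [hω]
    | succ n ih =>
      rw [Finset.sum_range_succ, add_assoc, ← h.lintegral_state_eq_add hQ hR hF, ← ih]
  have hfin : ∑' n, ∫⁻ ω, g (Z n ω) ∂P ≠ ∞ := by
    refine ne_top_of_le_ne_top h0 (ENNReal.tsum_le_of_sum_range_le fun n => ?_)
    rw [hsum n]
    exact le_self_add
  have hg0 := ENNReal.tendsto_atTop_zero_of_tsum_ne_top hfin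
  have hF0 : Filter.Tendsto (fun n => ∫⁻ ω, F (Z n ω) ∂P) Filter.atTop (nhds 0) := by
    have hKg := ENNReal.Tendsto.const_mul (a := K) hg0 (Or.inr hK)
    rw [mul_zero] at hKg
    refine tendsto_of_tendsto_of_tendsto_of_le_of_le tendsto_const_nhds hKg (fun _ => zero_le)
      fun n => ?_
    change ∫⁻ ω, F (Z n ω) ∂P ≤ K * ∫⁻ ω, g (Z n ω) ∂P
    rw [← lintegral_const_mul' _ _ hK]
    exact lintegral_mono fun ω => hFg _
  have hlim := (ENNReal.tendsto_nat_tsum fun n => ∫⁻ ω, g (Z n ω) ∂P).add hF0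
  rw [add_zero] at hlim
  refine tendsto_nhds_unique hlim ?_
  simp only [← hsum]
  exact tendsto_const_nhds

end IsJumpChain

/-! ### Transition rates of the exclusion process -/

section Rates

variable {p q α : ℝ}

lemma openASEPRate_nonneg {β : ℝ} (hp : 0 ≤ p) (hq : 0 ≤ q) (hα : 0 ≤ α) (hβ : 0 ≤ β)
    (η ζ : Finset ℕ) : 0 ≤ openASEPRate p q α β η ζ := by
  unfold openASEPRate
  have h1 : ∀ (c : ℝ) (P : Prop) [Decidable P], 0 ≤ c → 0 ≤ if P then c else 0 := by
    intro c P _ hc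
    split_ifs
    exacts [hc, le_rfl]
  refine add_nonneg (add_nonneg (add_nonneg ?_ ?_) ?_) ?_
  · exact Finset.sum_nonneg fun x _ => h1 _ _ hp
  · exact Finset.sum_nonneg fun x _ => h1 _ _ hq
  · exact h1 _ _ hα
  · exact h1 _ _ hβ

/-- Without ejection, every possible transition keeps the number of particles or raises it by
one. -/
lemma card_of_openASEPRate_ne_zero {η ζ : Finset ℕ} (h : openASEPRate p q α 0 η ζ ≠ 0) :
    ζ.card = η.card ∨ ζ.card = η.card + 1 := by
  have hmove : ∀ x ∈ η, ∀ w ∉ η, (insert w (η.erase x)).card = η.card := by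
    intro x hx w hw
    rw [Finset.card_insert_of_notMem fun hw' => hw (Finset.mem_of_mem_erase hw'),
      Finset.card_erase_add_one hx]
  by_contra hcard
  apply h
  have h1 : ∀ x ∈ η, (if x + 1 ∉ η ∧ ζ = insert (x + 1) (η.erase x) then p else 0) = 0 :=
    fun x hx => if_neg fun hc => hcard (Or.inl (by rw [hc.2, hmove x hx _ hc.1]))
  have h2 : ∀ x ∈ η, (if 0 < x ∧ x - 1 ∉ η ∧ ζ = insert (x - 1) (η.erase x) then q else 0) = 0 :=
    fun x hx => if_neg fun hc => hcard (Or.inl (by rw [hc.2.2, hmove x hx _ hc.2.1]))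
  have h3 : (if 0 ∉ η ∧ ζ = insert 0 η then α else 0) = 0 :=
    if_neg fun hc => hcard (Or.inr (by rw [hc.2, Finset.card_insert_of_notMem hc.1]))
  rw [openASEPRate, Finset.sum_eq_zero h1, Finset.sum_eq_zero h2, h3]
  simp

lemma card_of_jumpProb_ne_zero {η ζ : Finset ℕ} (h : jumpProb (openASEPRate p q α 0) η ζ ≠ 0) :
    ζ.card = η.card ∨ ζ.card = η.card + 1 := by
  unfold jumpProb at h
  split_ifs at h with h0 h1
  · exact Or.inl (by rw [h1])
  · exact absurd rfl h
  · exact card_of_openASEPRate_ne_zero fun hz => h (by rw [hz, zero_div])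

/-- The rates out of a one-particle configuration. For `x = 0` the sites `x - 1 = 0` and the pair
`{0, x} = {0}` are meaningless, but come with the rate `0`. -/
lemma openASEPRate_singleton (x : ℕ) (ζ : Finset ℕ) :
    openASEPRate p q α 0 {x} ζ =
      (if ζ = {x + 1} then p else 0) + (if ζ = {x - 1} then (if 0 < x then q else 0) else 0) +
        (if ζ = {0, x} then (if 0 < x then α else 0) else 0) := by
  rcases Nat.eq_zero_or_pos x with rfl | hx
  · simp [openASEPRate]
  · have h1 : x - 1 ≠ x := by omega
    have h2 : 0 ≠ x := hx.ne
    simp [openASEPRate, hx, h1, h2]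

lemma totalRate_singleton (x : ℕ) :
    totalRate (openASEPRate p q α 0) {x} =
      p + (if 0 < x then q else 0) + (if 0 < x then α else 0) := by
  have hs : ∀ (a : Finset ℕ) (c : ℝ), HasSum (fun ζ => if ζ = a then c else 0) c :=
    fun a c => hasSum_ite_eq a c
  unfold totalRate
  simp only [openASEPRate_singleton]
  exact (((hs _ _).add (hs _ _)).add (hs _ _)).tsum_eq

lemma totalRate_singleton_pos (hp : 0 < p) (hq : 0 ≤ q) (hα : 0 ≤ α) (x : ℕ) :
    0 < totalRate (openASEPRate p q α 0) {x} := by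
  rw [totalRate_singleton]
  split_ifs <;> linarith

/-- One step of the embedded chain from a configuration with a single particle, for a function
that vanishes once the second particle has arrived. -/
lemma tsum_jumpProb_singleton (hp : 0 < p) (hq : 0 ≤ q) (hα : 0 ≤ α) (x : ℕ)
    {F : Finset ℕ → ℝ≥0∞} (hF : ∀ η, η.card ≠ 1 → F η = 0) :
    ∑' w, ENNReal.ofReal (jumpProb (openASEPRate p q α 0) {x} w) * F w =
      ENNReal.ofReal (p / totalRate (openASEPRate p q α 0) {x}) * F {x + 1} +
      ENNReal.ofReal ((if 0 < x then q else 0) / totalRate (openASEPRate p q α 0) {x}) *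
        F {x - 1} := by
  have hr := totalRate_singleton_pos hp hq hα x
  set r := totalRate (openASEPRate p q α 0) {x} with hrdef
  have hq' : 0 ≤ (if 0 < x then q else 0) := by split_ifs <;> simp [hq]
  set q' := if 0 < x then q else 0 with hq'def
  have hterm : ∀ w, ENNReal.ofReal (jumpProb (openASEPRate p q α 0) {x} w) * F w =
      (if w = {x + 1} then ENNReal.ofReal (p / r) * F {x + 1} else 0) +
      (if w = {x - 1} then ENNReal.ofReal (q' / r) * F {x - 1} else 0) := by
    intro w
    have hJ : jumpProb (openASEPRate p q α 0) {x} w = openASEPRate p q α 0 {x} w / r :=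
      if_neg hr.ne'
    by_cases hw : w.card = 1
    · have h3 : (if w = {0, x} then (if 0 < x then α else 0) else 0) = 0 := by
        split_ifs with h1 h2
        · rw [h1, Finset.card_pair h2.ne] at hw
          exact absurd hw (by decide)
        · rfl
        · rfl
      rw [hJ, openASEPRate_singleton, h3, add_zero, ← hq'def, add_div, ENNReal.ofReal_add, add_mul]
      · congr 1
        · split_ifs with h1
          · rw [h1]
          · simp
        · split_ifs with h1
          · rw [h1]
          · simp
      · split_ifs <;> positivity
      · split_ifs <;> positivity
    · rw [hF w hw, mul_zero, if_neg, if_neg, add_zero]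
      · rintro rfl
        exact hw (Finset.card_singleton _)
      · rintro rfl
        exact hw (Finset.card_singleton _)
  rw [tsum_congr hterm, ENNReal.tsum_add, tsum_ite_eq, tsum_ite_eq]

end Rates

/-! ### The arrival time of the second particle -/

/-- Along a trajectory on which the number of particles starts at one, grows by at most one per
jump and does not stay equal to one, the second particle arrives after the total time spent in
one-particle configurations. -/
lemma secondParticleTime_eq_tsum {Ω : Type*} {X : ℝ≥0 → Ω → Finset ℕ} {ω : Ω} {z : ℕ → Finset ℕ}
    {h : ℕ → ℝ≥0∞} (h0 : (z 0).card = 1)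
    (hstep : ∀ n, (z (n + 1)).card = (z n).card ∨ (z (n + 1)).card = (z n).card + 1)
    (hpos : ∀ n, 0 < h n) (hne : ∃ n, (z n).card ≠ 1)
    (hfin : ∑' n, (if (z n).card = 1 then h n else 0) ≠ ∞)
    (hX : ∀ (n : ℕ) (t : ℝ≥0), ∑ i ∈ Finset.range n, h i ≤ (t : ℝ≥0∞) →
      (t : ℝ≥0∞) < ∑ i ∈ Finset.range (n + 1), h i → X t ω = z n) :
    (∃ t, (X t ω).card = 2) ∧
      secondParticleTime X ω = ∑' n, (if (z n).card = 1 then h n else 0) := by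
  classical
  obtain ⟨N, hN, hmin⟩ : ∃ N, (z N).card ≠ 1 ∧ ∀ m < N, (z m).card = 1 :=
    ⟨Nat.find hne, Nat.find_spec hne, fun m hm => not_not.1 (Nat.find_min hne hm)⟩
  have hN2 : (z N).card = 2 := by
    cases N with
    | zero => exact absurd h0 hN
    | succ m =>
      have h1 := hmin m m.lt_succ_self
      have h2 := hstep m
      omega
  have hmono : Monotone fun n => (z n).card :=
    monotone_nat_of_le_succ fun n => by have := hstep n; omega
  have hT : ∑' n, (if (z n).card = 1 then h n else 0) = ∑ i ∈ Finset.range N, h i := by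
    rw [tsum_eq_sum (s := Finset.range N)]
    · exact Finset.sum_congr rfl fun i hi => if_pos (hmin i (Finset.mem_range.1 hi))
    · intro n hn
      refine if_neg ?_
      have := hmono (not_lt.1 fun hlt => hn (Finset.mem_range.2 hlt))
      simp only [hN2] at this
      omega
  rw [hT] at hfin ⊢
  have hXT : X (∑ i ∈ Finset.range N, h i).toNNReal ω = z N := by
    refine hX N _ (ENNReal.coe_toNNReal hfin).ge ?_
    rw [ENNReal.coe_toNNReal hfin, Finset.sum_range_succ]
    exact ENNReal.lt_add_right hfin (hpos N).ne'
  refine ⟨⟨_, hXT ▸ hN2⟩, le_antisymm ?_ ?_⟩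
  · refine (iInf₂_le _ (hXT ▸ hN2)).trans ?_
    rw [ENNReal.coe_toNNReal hfin]
  · refine le_iInf₂ fun t ht => ?_
    by_contra! hlt
    -- `t` lies in one of the first `N` holding intervals, in which there is a single particle.
    have hex : ∃ n, (t : ℝ≥0∞) < ∑ i ∈ Finset.range n, h i := ⟨N, hlt⟩
    have hle : Nat.find hex ≤ N := Nat.find_min' hex hlt
    obtain ⟨m, hm⟩ : ∃ m, Nat.find hex = m + 1 := by
      refine Nat.exists_eq_succ_of_ne_zero fun hz => ?_
      have := Nat.find_spec hex
      simp [hz] at this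
    have hXt := hX m t (not_lt.1 (Nat.find_min hex (by omega))) (hm ▸ Nat.find_spec hex)
    rw [hXt, hmin m (by omega)] at ht
    exact absurd ht (by decide)

/-- A bounded nonnegative solution `f` of the Poisson equation of the single particle, killed at
rate `α` away from `0`, is the mean arrival time of the second particle. -/
lemma secondParticleTime_of_poisson {Ω : Type*} [MeasurableSpace Ω] {P : Measure Ω}
    [IsProbabilityMeasure P] {p q α : ℝ} (hp : 0 < p) (hq : 0 ≤ q) (hpq : p + q = 1) (hα : 0 < α)
    {y : ℕ} {X : ℝ≥0 → Ω → Finset ℕ}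
    (hX : IsMarkovJumpProcess (openASEPRate p q α 0) {y} P X)
    {f : ℕ → ℝ} {C : ℝ} (hf0 : ∀ x, 0 ≤ f x) (hfC : ∀ x, f x ≤ C)
    (hfz : p * f 0 = 1 + p * f 1)
    (hfs : ∀ x, (1 + α) * f (x + 1) = 1 + p * f (x + 2) + q * f x) :
    (∀ᵐ ω ∂P, ∃ t : ℝ≥0, (X t ω).card = 2) ∧
    AEMeasurable (secondParticleTime X) P ∧
    ∫⁻ ω, secondParticleTime X ω ∂P = ENNReal.ofReal (f y) := by
  classical
  obtain ⟨Z, H, hZ, hH, hlaw, hXZ⟩ := hX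
  have h : IsJumpChain (openASEPRate p q α 0) {y} P Z H := ⟨hZ, hH, hlaw⟩
  have hQ : ∀ z w, 0 ≤ openASEPRate p q α 0 z w :=
    openASEPRate_nonneg hp.le hq hα.le le_rfl
  have hstep : ∀ᵐ ω ∂P, ∀ n,
      (Z (n + 1) ω).card = (Z n ω).card ∨ (Z (n + 1) ω).card = (Z n ω).card + 1 := by
    filter_upwards [h.ae_jumpProb_ne_zero hQ] with ω hω n
    exact card_of_jumpProb_ne_zero (hω n)
  have hinit : ∀ᵐ ω ∂P, (Z 0 ω).card = 1 := by
    filter_upwards [h.ae_init hQ] with ω hω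
    rw [hω, Finset.card_singleton]
  have hR : ∀ n, ∀ᵐ ω ∂P, Z n ω ∈ {η : Finset ℕ | 1 ≤ η.card} := by
    intro n
    filter_upwards [hstep, hinit] with ω h1 h2
    induction n with
    | zero => exact h2.ge
    | succ n ih => have := h1 n; omega
  -- For a one-particle configuration `η = {x}` the site `x` is `η.sum id`.
  set F : Finset ℕ → ℝ≥0∞ :=
    fun η => if η.card = 1 then ENNReal.ofReal (f (η.sum id)) else 0 with hFdef
  set g : Finset ℕ → ℝ≥0∞ := fun η =>
    if η.card = 1 then (ENNReal.ofReal (totalRate (openASEPRate p q α 0) η))⁻¹ else 0 with hgdef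
  have hFs : ∀ x, F {x} = ENNReal.ofReal (f x) := by simp [hFdef]
  have hrpos := totalRate_singleton_pos hp hq hα.le
  have hrle : ∀ x, totalRate (openASEPRate p q α 0) {x} ≤ 1 + α := by
    intro x
    rw [totalRate_singleton]
    split_ifs <;> linarith
  have hgs : ∀ x, g {x} = ENNReal.ofReal (1 / totalRate (openASEPRate p q α 0) {x}) := by
    intro x
    simp only [hgdef, Finset.card_singleton, if_true]
    rw [one_div, ENNReal.ofReal_inv_of_pos (hrpos x)]
  have hpoisson : ∀ η ∈ {η : Finset ℕ | 1 ≤ η.card}, F η = g η +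
      ∑' w, ENNReal.ofReal (jumpProb (openASEPRate p q α 0) η w) * F w := by
    intro η hη
    by_cases hη1 : η.card = 1
    · obtain ⟨x, rfl⟩ := Finset.card_eq_one.1 hη1
      rw [tsum_jumpProb_singleton hp hq hα.le x (F := F) fun η hη => if_neg hη]
      have hr := hrpos x
      have hqx : 0 ≤ (if 0 < x then q else 0) := by split_ifs <;> simp [hq]
      rw [hFs, hFs, hFs, hgs, ← ENNReal.ofReal_mul (by positivity),
        ← ENNReal.ofReal_mul (by positivity),
        ← ENNReal.ofReal_add (mul_nonneg (by positivity) (hf0 _))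
          (mul_nonneg (by positivity) (hf0 _)),
        ← ENNReal.ofReal_add (by positivity) (add_nonneg (mul_nonneg (by positivity) (hf0 _))
          (mul_nonneg (by positivity) (hf0 _)))]
      congr 1
      rw [eq_comm, div_mul_eq_mul_div, div_mul_eq_mul_div, ← add_div, ← add_div,
        div_eq_iff hr.ne', totalRate_singleton]
      cases x with
      | zero => simp; linarith
      | succ x =>
        have := hfs x
        simp only [Nat.succ_pos, if_true, Nat.add_sub_cancel]
        rw [hpq, mul_comm (f (x + 1)), this]
        ring
    · have hzero : ∀ w, ENNReal.ofReal (jumpProb (openASEPRate p q α 0) η w) * F w = 0 := by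
        intro w
        by_cases hJ : jumpProb (openASEPRate p q α 0) η w = 0
        · rw [hJ, ENNReal.ofReal_zero, zero_mul]
        · have h1 := card_of_jumpProb_ne_zero hJ
          have h2 : 1 ≤ η.card := hη
          have h3 : F w = 0 := if_neg (by omega)
          rw [h3, mul_zero]
      rw [ENNReal.tsum_eq_zero.2 hzero, add_zero]
      exact (if_neg hη1).trans (if_neg hη1).symm
  have hFg : ∀ η, F η ≤ ENNReal.ofReal (C * (1 + α)) * g η := by
    intro η
    by_cases hη1 : η.card = 1
    · obtain ⟨x, rfl⟩ := Finset.card_eq_one.1 hη1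
      have hr := hrpos x
      have hC : 0 ≤ C := (hf0 0).trans (hfC 0)
      rw [hFs, hgs, ← ENNReal.ofReal_mul (by positivity)]
      refine ENNReal.ofReal_le_ofReal ?_
      rw [mul_one_div, le_div_iff₀ hr]
      exact mul_le_mul (hfC x) (hrle x) hr.le hC
    · exact (if_neg hη1).trans_le zero_le
  have hsum : ∑' n, ∫⁻ ω, g (Z n ω) ∂P = ENNReal.ofReal (f y) := by
    rw [h.tsum_lintegral_state hQ hR hpoisson ENNReal.ofReal_ne_top hFg
      (by rw [hFs]; exact ENNReal.ofReal_ne_top), hFs]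
  have hcardm : ∀ n, MeasurableSet {ω | (Z n ω).card = 1} :=
    fun n => h.measurableSet_state_mem n {η | η.card = 1}
  have hmeas : ∀ n, Measurable fun ω => if (Z n ω).card = 1 then H n ω else 0 :=
    fun n => Measurable.ite (hcardm n) (hH n) measurable_const
  have hterm : ∀ n, ∫⁻ ω, (if (Z n ω).card = 1 then H n ω else 0) ∂P =
      ∫⁻ ω, g (Z n ω) ∂P := by
    intro n
    rw [h.lintegral_state, lintegral_eq_tsum_setLIntegral_fiber P (hZ n)]
    refine tsum_congr fun η => ?_
    rw [setLIntegral_congr_fun (g := fun ω => if η.card = 1 then H n ω else 0) (hZ n η)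
      fun ω (hω : Z n ω = η) => by simp only [hω]]
    by_cases hη1 : η.card = 1
    · simp only [hη1, hgdef, if_true]
      obtain ⟨x, rfl⟩ := Finset.card_eq_one.1 hη1
      exact h.setLIntegral_holding hQ n {x} (hrpos x)
    · simp [hη1, hgdef]
  have hTint : ∫⁻ ω, (∑' n, if (Z n ω).card = 1 then H n ω else 0) ∂P =
      ENNReal.ofReal (f y) := by
    rw [lintegral_tsum fun n => (hmeas n).aemeasurable, tsum_congr hterm, hsum]
  have hTm : Measurable fun ω => ∑' n, if (Z n ω).card = 1 then H n ω else 0 :=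
    Measurable.tsum hmeas
  have hTfin : ∀ᵐ ω ∂P, (∑' n, if (Z n ω).card = 1 then H n ω else 0) ≠ ∞ := by
    filter_upwards [ae_lt_top hTm (hTint.trans_ne ENNReal.ofReal_ne_top)] with ω hω
    exact hω.ne
  -- Each visit to a one-particle configuration costs at least `1 / (1 + α)` in mean, so that
  -- by the Borel-Cantelli lemma there are only finitely many of them.
  have hleave : ∀ᵐ ω ∂P, ∃ n, (Z n ω).card ≠ 1 := by
    have hle : ∀ n, P {ω | (Z n ω).card = 1} ≤
        ENNReal.ofReal (1 + α) * ∫⁻ ω, g (Z n ω) ∂P := by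
      intro n
      rw [← lintegral_indicator_one (hcardm n), ← lintegral_const_mul' _ _ ENNReal.ofReal_ne_top]
      refine lintegral_mono fun ω => ?_
      by_cases hω : (Z n ω).card = 1
      · rw [Set.indicator_of_mem (s := {ω | (Z n ω).card = 1}) hω]
        obtain ⟨x, hx⟩ := Finset.card_eq_one.1 hω
        have hr := hrpos x
        rw [hx, hgs, ← ENNReal.ofReal_mul (by positivity), Pi.one_apply, ← ENNReal.ofReal_one]
        refine ENNReal.ofReal_le_ofReal ?_
        rw [mul_one_div, le_div_iff₀ hr, one_mul]
        exact hrle x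
      · exact (Set.indicator_of_notMem (s := {ω | (Z n ω).card = 1}) hω _).trans_le zero_le
    have hP : ∑' n, P {ω | (Z n ω).card = 1} ≠ ∞ := by
      refine ne_top_of_le_ne_top ?_ (ENNReal.tsum_le_tsum hle)
      rw [ENNReal.tsum_mul_left, hsum]
      exact ENNReal.mul_ne_top ENNReal.ofReal_ne_top ENNReal.ofReal_ne_top
    filter_upwards [ae_eventually_notMem hP] with ω hω
    exact hω.exists
  have hpath : ∀ᵐ ω ∂P, (∃ t : ℝ≥0, (X t ω).card = 2) ∧
      secondParticleTime X ω = ∑' n, if (Z n ω).card = 1 then H n ω else 0 := by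
    filter_upwards [hinit, hstep, h.ae_holding_pos hQ, hleave, hTfin, hXZ]
      with ω h1 h2 h3 h4 h5 h6
    exact secondParticleTime_eq_tsum h1 h2 h3 h4 h5 h6
  have hT : secondParticleTime X =ᵐ[P] fun ω => ∑' n, if (Z n ω).card = 1 then H n ω else 0 :=
    hpath.mono fun ω hω => hω.2
  exact ⟨hpath.mono fun ω hω => hω.1, ⟨_, hTm, hT⟩, (lintegral_congr_ae hT).trans hTint⟩

/-! ### The root `xiPlus` -/

section XiPlus

variable {p q s : ℝ}

/-- `xiPlus` is a root of the characteristic equation, cleared of denominators. -/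
lemma xiPlus_root (hp : 0 < p) (hq : 0 < q) (hpq : p + q = 1) (hs : 0 < s) :
    q * xiPlus p q s ^ 2 + p = (1 + s) * xiPlus p q s := by
  have hD : 0 ≤ (s + 1) ^ 2 - 4 * p * q := by nlinarith [sq_nonneg (p - q), sq_nonneg s]
  have hsq := Real.sq_sqrt hD
  have hd : 2 * q * xiPlus p q s = s + 1 + Real.sqrt ((s + 1) ^ 2 - 4 * p * q) := by
    unfold xiPlus
    field_simp
  have h2 : Real.sqrt ((s + 1) ^ 2 - 4 * p * q) = 2 * q * xiPlus p q s - (s + 1) := by linarith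
  rw [h2] at hsq
  have h4 : (4 * q) * (q * xiPlus p q s ^ 2 + p) = (4 * q) * ((1 + s) * xiPlus p q s) := by
    linarith
  exact mul_left_cancel₀ (by positivity) h4

lemma lt_mul_xiPlus_sub_one (hp : 0 < p) (hq : 0 < q) (hpq : p + q = 1) (hs : 0 < s) :
    s < q * (xiPlus p q s - 1) := by
  have hd : 2 * q * xiPlus p q s = s + 1 + Real.sqrt ((s + 1) ^ 2 - 4 * p * q) := by
    unfold xiPlus
    field_simp
  have h1 : s + q - p < Real.sqrt ((s + 1) ^ 2 - 4 * p * q) := by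
    apply Real.lt_sqrt_of_sq_lt
    obtain rfl : p = 1 - q := by linarith
    nlinarith [mul_pos hs hp]
  linarith

lemma one_lt_xiPlus (hp : 0 < p) (hq : 0 < q) (hpq : p + q = 1) (hs : 0 < s) :
    1 < xiPlus p q s := by
  have h1 := lt_mul_xiPlus_sub_one hp hq hpq hs
  have h2 : 0 < xiPlus p q s - 1 := pos_of_mul_pos_right (hs.trans h1) hq.le
  linarith

end XiPlus

theorem mainTheorem10 {Ω : Type*} [MeasurableSpace Ω] (P : Measure Ω) [IsProbabilityMeasure P]
    (p q α : ℝ) (hp : 0 < p) (hq : 0 ≤ q) (hpq : p + q = 1) (hα : 0 < α) (y : ℕ)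
    (X : ℝ≥0 → Ω → Finset ℕ)
    (hX : IsMarkovJumpProcess (openASEPRate p q α 0) {y} P X) :
    (∀ᵐ ω ∂P, ∃ t : ℝ≥0, (X t ω).card = 2) ∧
    AEMeasurable (secondParticleTime X) P ∧
    (0 < q →
      ∫⁻ ω, secondParticleTime X ω ∂P =
        ENNReal.ofReal
          (1 / α + xiPlus p q α ^ (-(y : ℤ)) / (q * (xiPlus p q α - 1) - α))) := by
  rcases hq.eq_or_lt with rfl | hq'
  · -- Totally asymmetric case: the particle leaves `0` after a mean time `1 / p` and never returns.
    have hmain := secondParticleTime_of_poisson hp hq hpq hα hX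
      (f := fun x => 1 / α + if x = 0 then 1 / p else 0) (C := 1 / α + 1 / p)
      (fun x => by split_ifs <;> positivity)
      (fun x => by
        have : 0 < 1 / p := by positivity
        split_ifs <;> linarith)
      (by simp; field_simp; ring) (fun x => by simp; field_simp; linarith)
    exact ⟨hmain.1, hmain.2.1, fun h => absurd h (lt_irrefl 0)⟩
  · have h1 := one_lt_xiPlus hp hq' hpq hα
    have h2 := lt_mul_xiPlus_sub_one hp hq' hpq hα
    have hroot := xiPlus_root hp hq' hpq hα
    set ξ := xiPlus p q α
    have hξ : 0 < ξ := by linarith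
    have hd : 0 < q * (ξ - 1) - α := by linarith
    have hmain := secondParticleTime_of_poisson hp hq hpq hα hX
      (f := fun x => 1 / α + ξ ^ (-(x : ℤ)) / (q * (ξ - 1) - α))
      (C := 1 / α + 1 / (q * (ξ - 1) - α)) (fun x => by positivity)
      (fun x => by
        gcongr
        rw [zpow_neg, zpow_natCast]
        exact inv_le_one_of_one_le₀ (one_le_pow₀ h1.le))
      (by
        have h3 : p * (ξ - 1) = (q * (ξ - 1) - α) * ξ := by
          obtain rfl : p = 1 - q := by linarith
          linarith
        have hd0 := hd.ne'
        simp
        generalize q * (ξ - 1) - α = d at *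
        field_simp
        linear_combination α * h3)
      (fun x => by
        have hd0 := hd.ne'
        generalize q * (ξ - 1) - α = d at *
        simp only [zpow_neg, zpow_natCast, pow_succ]
        obtain rfl : p = 1 - q := by linarith
        field_simp
        linear_combination (-α) * hroot)
    exact ⟨hmain.1, hmain.2.1, fun _ => hmain.2.2⟩
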